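/- All graphs are finite and simple. For a graph $H$ and an integer $n\ge 0$ let $\mathrm{ex}(n,H)$ be the largest number of edges of a graph on $n$ vertices that contains no (not necessarily induced) subgraph isomorphic to $H$ (and $0$ if there is no such graph). The subdivision of a graph $G$ is the graph obtained from $G$ by replacing its edges with internally disjoint paths of length $2$. Theorem 1.2. Let $H$ be a bipartite graph that contains no (not necessarily induced) cycle $C_4$ and that has a bipartition in which every vertex of one side has degree at most $2$. Then there are constants $C,\delta>0$, depending only on $H$, such that $\mathrm{ex}(n,H)\le C\,n^{3/2-\delta}$ for all $n$. Equivalently, for every graph $G$ there are constants $C,\delta>0$, depending only on $G$, such that the subdivision $G'$ of $G$ satisfies $\mathrm{ex}(n,G')\le C\,n^{3/2-\delta}$ for all $n$. In particular, for every integer $t\ge 3$ there are constants $\alpha<3/2$ and $C>0$ such that the subdivision $K_t'$ of the complete graph $K_t$ satisfies $\mathrm{ex}(n,K_t')\le C\,n^{\alpha}$ for all $n$, which answers a question of Erdős from 1988. -/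

import Mathlib

namespace SimpleGraph

/-- The (1-)subdivision of a graph `G`: every edge `e = uv` of `G` is replaced by a path `u - e - v`
of length two through a new vertex, one for each edge. The vertices are those of `G` together with
the edges of `G`, and the only adjacencies are between a vertex of `G` and an edge of `G` that is
incident to it. -/
def subdivision {V : Type*} (G : SimpleGraph V) : SimpleGraph (V ⊕ G.edgeSet) where
  Adj x y := match x, y with
    | .inl v, .inr e => v ∈ (e : Sym2 V)
    | .inr e, .inl v => v ∈ (e : Sym2 V)
    | .inl _, .inl _ => False
    | .inr _, .inr _ => False
  symm := ⟨by rintro (_ | _) (_ | _) h <;> exact h⟩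
  loopless := ⟨by rintro (_ | _) h <;> exact h⟩

end SimpleGraph

/-! Any graph as in the first part embeds into the subdivision `K_t'` of a complete graph, so it
suffices to bound the number of edges of a `K_t'`-free graph `G` on `n` vertices. The argument
follows the idea of light and heavy pairs, due to Janzer.

Call a pair of vertices *heavy* if it has at least `t² + t` common neighbours, and *light* if it has
at least one but fewer. A set of `t` pairwise heavy vertices extends to a copy of `K_t'` by Hall's
theorem, so inside each neighbourhood Turán's theorem yields a positive proportion of light pairs.
Summing over all neighbourhoods, where each light pair is counted fewer than `t² + t` times, bounds
the degree sum of a set `U` by the number of light pairs in it (`sq_sum_degree_le`).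

This inequality is used twice. Applied to the set of vertices of degree larger than a multiple of
`√n`, it shows that these carry only `O(n)` edges (`sum_degree_le_of_lt_degree`). If `G` has at
least `C n ^ (3 / 2 - δ)` edges, then what remains has a subgraph on at least `n ^ (1 - δ)`
vertices, up to a constant, whose degrees lie between `n ^ (1 / 2 - δ)` and `n ^ (1 / 2)`, again up to
constants (`exists_subset_le_card_adj`). Inside this subgraph the inequality provides, for every
large set `U`, a vertex with many light partners in `U`. So `t` branch vertices can be chosen
greedily, each from the common light partners of the previous ones; each step shrinks the reservoir
by a factor `n ^ (2 δ)` only. Since the previous branch vertices form light pairs, they have few common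
neighbours, and avoiding the neighbours of these costs only `O(√n)` vertices per step. In the end no
three branch vertices have a common neighbour, so the pairs have distinct common neighbours, which
gives `K_t'` (`subdivision_top_isContained_of_degree`). The choice `δ = 1 / (4 t + 4)` makes the
exponents balance. -/

open Finset

namespace SimpleGraph

/-! ### Copies of a subdivision -/

/-- A copy of the subdivision of `G` is a choice of branch vertices together with a system of
distinct joints, disjoint from the branch vertices, each adjacent to both ends of its edge. -/
theorem subdivision_isContained_of_injective {W V : Type*} {G : SimpleGraph W} {H : SimpleGraph V}
    (f : W → V) (g : G.edgeSet → V) (hf : f.Injective) (hg : g.Injective)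
    (hfg : ∀ w e, f w ≠ g e) (hadj : ∀ e : G.edgeSet, ∀ w ∈ (e : Sym2 W), H.Adj (f w) (g e)) :
    G.subdivision ⊑ H := by
  refine ⟨⟨⟨Sum.elim f g, ?_⟩, hf.sumElim hg hfg⟩⟩
  rintro (a | a) (b | b) h
  · exact h.elim
  · exact hadj b a h
  · exact (hadj a b h).symm
  · exact h.elim

theorem subdivision_isContained_subdivision_top {W X : Type*} (G : SimpleGraph W) (f : W ↪ X) :
    G.subdivision ⊑ (⊤ : SimpleGraph X).subdivision := by
  have hmem (e : G.edgeSet) : Sym2.map f e ∈ (⊤ : SimpleGraph X).edgeSet := by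
    obtain ⟨e, he⟩ := e
    induction e with | _ a b => simpa using G.ne_of_adj he
  refine subdivision_isContained_of_injective (fun w ↦ .inl (f w))
    (fun e ↦ .inr ⟨Sym2.map f e, hmem e⟩) (Sum.inl_injective.comp f.injective) ?_ (by simp) ?_
  · intro e e' h
    simp only [Sum.inr.injEq, Subtype.mk.injEq] at h
    exact Subtype.ext (Sym2.map.injective f.injective h)
  · intro e w hw
    change f w ∈ Sym2.map f e
    exact Sym2.mem_map.2 ⟨w, hw, rfl⟩

/-- If the two-element neighbourhoods of two distinct vertices agree, they span a four-cycle. -/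
theorem cycleGraph_four_isContained {V : Type*} {H : SimpleGraph V} {a b u v : V} (hab : a ≠ b)
    (huv : u ≠ v) (hua : H.Adj u a) (hub : H.Adj u b) (hva : H.Adj v a) (hvb : H.Adj v b) :
    cycleGraph 4 ⊑ H := by
  refine ⟨⟨⟨![a, u, b, v], ?_⟩, ?_⟩⟩
  · intro i j h
    revert h
    fin_cases i <;> fin_cases j <;>
      simp [cycleGraph_adj, hua, hub, hva, hvb, hua.symm, hub.symm, hva.symm, hvb.symm] <;>
      exact fun h ↦ absurd h (by decide)
  · intro i j h
    revert h
    fin_cases i <;> fin_cases j <;>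
      simp [hab, huv, hab.symm, huv.symm, hua.ne, hub.ne, hva.ne, hvb.ne, hua.ne', hub.ne', hva.ne',
        hvb.ne']

/-- A vertex `v` of the side `B` with two neighbours subdivides the edge between them; a vertex `v`
with a single neighbour `a` subdivides an edge between `a` and a new vertex `(v, true)`. -/
theorem exists_edge_of_degree_le_two {V : Type*} [Fintype V] (H : SimpleGraph V)
    [DecidableRel H.Adj] (v : V) (h0 : H.degree v ≠ 0) (h2 : H.degree v ≤ 2) :
    ∃ e ∈ (⊤ : SimpleGraph (V × Bool)).edgeSet, (∀ a, (a, false) ∈ e ↔ H.Adj v a) ∧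
      (∀ x, (x, true) ∈ e → x = v) ∧
      ((v, true) ∈ e ∨ ∃ a b, a ≠ b ∧ H.Adj v a ∧ H.Adj v b) := by
  classical
  have h12 : #(H.neighborFinset v) = 1 ∨ #(H.neighborFinset v) = 2 := by
    rw [card_neighborFinset_eq_degree]; lia
  obtain h | h := h12
  · obtain ⟨a, ha⟩ := card_eq_one.1 h
    refine ⟨s((a, false), (v, true)), by simp, fun x ↦ ?_, by simp, by simp⟩
    rw [← mem_neighborFinset, ha]; simp
  · obtain ⟨a, b, hab, hN⟩ := card_eq_two.1 h
    have hadj (x : V) : H.Adj v x ↔ x = a ∨ x = b := by rw [← mem_neighborFinset, hN]; simp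
    refine ⟨s((a, false), (b, false)), by simpa using hab, fun x ↦ ?_, by simp,
      .inr ⟨a, b, hab, ?_, ?_⟩⟩ <;> simp [hadj]

/-- A `C₄`-free bipartite graph whose degrees on one side are at most two is a subgraph of the
subdivision of a complete graph. -/
theorem IsBipartiteWith.isContained_subdivision_top {V : Type*} [Fintype V] {H : SimpleGraph V}
    [DecidableRel H.Adj] {A B : Set V} (hAB : H.IsBipartiteWith A B)
    (hB : ∀ v ∈ B, H.degree v ≤ 2) (hH : (cycleGraph 4).Free H) :
    H ⊑ (⊤ : SimpleGraph (V × Bool)).subdivision := by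
  classical
  have key (v : V) : ∃ p : (V × Bool) ⊕ (⊤ : SimpleGraph (V × Bool)).edgeSet,
      if v ∈ B ∧ H.degree v ≠ 0 then ∃ e, p = .inr e ∧
        (∀ a, (a, false) ∈ (e : Sym2 (V × Bool)) ↔ H.Adj v a) ∧
        (∀ x, (x, true) ∈ (e : Sym2 (V × Bool)) → x = v) ∧
        ((v, true) ∈ (e : Sym2 (V × Bool)) ∨ ∃ a b, a ≠ b ∧ H.Adj v a ∧ H.Adj v b)
      else p = .inl (v, false) := by
    split_ifs with h
    · obtain ⟨e, he, h'⟩ := H.exists_edge_of_degree_le_two v h.2 (hB v h.1)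
      exact ⟨.inr ⟨e, he⟩, ⟨e, he⟩, rfl, h'⟩
    · exact ⟨_, rfl⟩
  choose φ hφ using key
  have hpos {v w : V} (h : H.Adj v w) : H.degree v ≠ 0 :=
    ((H.degree_pos_iff_exists_adj v).2 ⟨w, h⟩).ne'
  have hcross {v w : V} (hv : v ∈ B) (hw : w ∉ B) (h : H.Adj v w) :
      (subdivision ⊤).Adj (φ v) (φ w) := by
    have h1 := hφ v
    have h2 := hφ w
    rw [if_pos ⟨hv, hpos h⟩] at h1
    rw [if_neg (by simp [hw])] at h2
    obtain ⟨e, he, ha, -⟩ := h1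
    rw [he, h2]
    exact (ha w).2 h
  refine ⟨⟨⟨φ, ?_⟩, ?_⟩⟩
  · intro v w h
    obtain ⟨hv, hw⟩ | ⟨hv, hw⟩ := hAB.mem_of_adj h
    · exact (hcross hw (fun h' ↦ hAB.disjoint.le_bot ⟨hv, h'⟩) h.symm).symm
    · exact hcross hv (fun h' ↦ hAB.disjoint.le_bot ⟨hw, h'⟩) h
  · intro v w h
    change φ v = φ w at h
    have h1 := hφ v
    have h2 := hφ w
    split_ifs at h1 h2 with hv hw hw
    · obtain ⟨e, he, ha, ht, h3⟩ := h1
      obtain ⟨e', he', ha', ht', -⟩ := h2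
      obtain rfl : e = e' := by simpa [he, he'] using h
      obtain h3 | ⟨a, b, hab, hva, hvb⟩ := h3
      · exact ht' v h3
      · by_contra hvw
        exact hH (cycleGraph_four_isContained hab hvw hva hvb ((ha' a).1 ((ha a).2 hva))
          ((ha' b).1 ((ha b).2 hvb)))
    · obtain ⟨e, he, -⟩ := h1
      simp [he, h2] at h
    · obtain ⟨e, he, -⟩ := h2
      simp [he, h1] at h
    · simpa [h1, h2] using h

/-! ### Light pairs -/

/-- Turán's theorem, as a lower bound for the number of ordered pairs (the diagonal included) of a
set without a `t`-clique that are not adjacent. -/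
theorem sq_card_le_mul_sum_not_adj {V : Type*} {t : ℕ} (H : SimpleGraph V) [DecidableRel H.Adj]
    (s : Finset V) (h : ∀ F ⊆ s, #F = t → ¬ H.IsClique F) :
    #s ^ 2 ≤ t * ∑ u ∈ s, #{v ∈ s | ¬ H.Adj u v} := by
  classical
  obtain _ | r := t
  · exact absurd (by simp) (h ∅ (by simp) (by simp))
  have hfree : (H.induce (s : Set V)).CliqueFree (r + 1) := by
    intro F hF
    refine h (F.map (.subtype _)) (fun x hx ↦ ?_) (by simpa using hF.card_eq) ?_
    · obtain ⟨y, -, rfl⟩ := mem_map.1 hx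
      exact y.2
    · intro x hx y hy hxy
      obtain ⟨x, hxF, rfl⟩ := mem_map.1 (mem_coe.1 hx)
      obtain ⟨y, hyF, rfl⟩ := mem_map.1 (mem_coe.1 hy)
      exact hF.isClique (mem_coe.2 hxF) (mem_coe.2 hyF) fun h ↦ hxy (by rw [h])
  obtain rfl | hr := r.eq_zero_or_pos
  · obtain rfl : s = ∅ := by
      by_contra hs
      obtain ⟨x, hx⟩ := nonempty_iff_ne_empty.2 hs
      exact h {x} (by simpa using hx) (by simp) (by simp)
    simp
  have h1 := hfree.card_edgeFinset_le
  simp only [← card_edgeFinset_turanGraph] at h1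
  have h2 := mul_card_edgeFinset_turanGraph_le (n := Fintype.card (s : Set V)) (r := r)
  have h3 := sum_degrees_eq_twice_card_edges (H.induce (s : Set V))
  have h4 : ∑ v, (H.induce (s : Set V)).degree v = ∑ u ∈ s, #{v ∈ s | H.Adj u v} := by
    rw [← sum_coe_sort s]
    refine sum_congr rfl fun v _ ↦ ?_
    rw [← card_neighborFinset_eq_degree, neighborFinset_eq_filter, ← card_map (.subtype _)]
    congr 1
    ext x
    simp [and_comm]
  have h5 : ∑ u ∈ s, #{v ∈ s | H.Adj u v} + ∑ u ∈ s, #{v ∈ s | ¬ H.Adj u v} = #s ^ 2 := by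
    rw [← sum_add_distrib, sum_congr rfl fun u _ ↦ card_filter_add_card_filter_not _]
    simp [sq]
  have h6 : Fintype.card (s : Set V) = #s := by simp
  rw [h6] at h1 h2
  obtain ⟨r, rfl⟩ := Nat.exists_eq_add_one.2 hr
  simp only [Nat.add_sub_cancel] at h2
  have h7 := (Nat.mul_le_mul_left (2 * (r + 1)) h1).trans h2
  rw [mul_right_comm, ← h3, h4, mul_comm] at h7
  have h8 := congrArg ((r + 1) * ·) h5
  simp only [mul_add] at h8
  refine le_trans ?_ (Nat.mul_le_mul_right _ (Nat.le_succ (r + 1)))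
  linarith

section Light

variable {V : Type*} [Fintype V] [DecidableEq V] (G : SimpleGraph V) [DecidableRel G.Adj]

/-- The number of common neighbours of two vertices. -/
def codegree (u v : V) : ℕ := #(G.neighborFinset u ∩ G.neighborFinset v)

theorem codegree_comm (u v : V) : G.codegree u v = G.codegree v u := by
  rw [codegree, codegree, inter_comm]

/-- Two distinct vertices form a light pair if they have at least one but fewer than `T` common
neighbours. -/
abbrev IsLightPair (T : ℕ) (u v : V) : Prop :=
  u ≠ v ∧ 0 < G.codegree u v ∧ G.codegree u v < T

variable {G}

theorem IsLightPair.symm {T : ℕ} {u v : V} (h : G.IsLightPair T u v) : G.IsLightPair T v u := by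
  rw [IsLightPair, codegree_comm]; exact ⟨h.1.symm, h.2⟩

theorem codegree_pos_of_adj {b u v : V} (hu : G.Adj b u) (hv : G.Adj b v) :
    0 < G.codegree u v :=
  card_pos.2 ⟨b, by simp [hu.symm, hv.symm]⟩

/-- The number of ordered light pairs inside `U`. -/
def lightCount (G : SimpleGraph V) [DecidableRel G.Adj] (T : ℕ) (U : Finset V) : ℕ :=
  ∑ u ∈ U, #{v ∈ U | G.IsLightPair T u v}

/-- If all pairs in a set of `t` vertices have many common neighbours, then distinct common
neighbours can be chosen by Hall's theorem. -/
theorem subdivision_top_isContained_of_le_codegree {t : ℕ} (F : Finset V) (hF : #F = t)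
    (h : ∀ x ∈ F, ∀ y ∈ F, x ≠ y → t ^ 2 + t ≤ G.codegree x y) :
    (⊤ : SimpleGraph (Fin t)).subdivision ⊑ G := by
  let f : Fin t ≃ F := (Fintype.equivFinOfCardEq (by simpa using hF)).symm
  -- Each edge has at least `t ^ 2` candidates outside `F`, and there are at most `t ^ 2` edges.
  let N (e : (⊤ : SimpleGraph (Fin t)).edgeSet) : Finset V :=
    {b | (∀ i ∈ (e : Sym2 (Fin t)), G.Adj (f i) b) ∧ b ∉ F}
  have hN (e) : t ^ 2 ≤ #(N e) := by
    obtain ⟨e, he⟩ := e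
    induction e with | _ i j =>
    have hij : (f i : V) ≠ f j := by
      have : i ≠ j := by simpa using he
      exact fun h ↦ this (f.injective (Subtype.ext h))
    have h1 := h _ (f i).2 _ (f j).2 hij
    have h2 : (G.neighborFinset (f i) ∩ G.neighborFinset (f j)) \ F ⊆ N ⟨s(i, j), he⟩ := by
      intro b; simp [N, and_assoc]
    have h3 := card_le_card h2
    have h4 := le_card_sdiff F (G.neighborFinset (f i) ∩ G.neighborFinset (f j))
    unfold codegree at h1
    lia
  have hcard : Fintype.card (⊤ : SimpleGraph (Fin t)).edgeSet ≤ t ^ 2 := by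
    rw [← edgeFinset_card]
    refine (card_edgeFinset_le_card_choose_two).trans ?_
    rw [Fintype.card_fin]
    exact Nat.choose_le_pow t 2
  obtain ⟨g, hg, hgN⟩ := (all_card_le_biUnion_card_iff_exists_injective N).1 fun s ↦ by
    obtain rfl | ⟨e, he⟩ := s.eq_empty_or_nonempty
    · simp
    · exact ((card_le_univ s).trans hcard).trans
        ((hN e).trans (card_le_card (subset_biUnion_of_mem N he)))
  have hgN' (e) := (mem_filter_univ _).1 (hgN e)
  exact subdivision_isContained_of_injective (fun i ↦ (f i : V)) g
    (Subtype.val_injective.comp f.injective) hg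
    (fun w e h ↦ (hgN' e).2 (h ▸ (f w).2)) (fun e w hw ↦ (hgN' e).1 w hw)

variable {t : ℕ}

theorem sq_card_le_of_common_neighbor (hG : (⊤ : SimpleGraph (Fin t)).subdivision.Free G)
    (b : V) (s : Finset V) (hs : ∀ u ∈ s, G.Adj b u) :
    #s ^ 2 ≤ t * (#s + G.lightCount (t ^ 2 + t) s) := by
  let H : SimpleGraph V :=
    { Adj := fun u v ↦ u ≠ v ∧ t ^ 2 + t ≤ G.codegree u v
      symm := ⟨fun u v h ↦ ⟨h.1.symm, by rw [codegree_comm]; exact h.2⟩⟩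
      loopless := ⟨fun u h ↦ h.1 rfl⟩ }
  have : DecidableRel H.Adj := fun u v ↦
    inferInstanceAs (Decidable (u ≠ v ∧ t ^ 2 + t ≤ G.codegree u v))
  refine (sq_card_le_mul_sum_not_adj (t := t) H s fun F _ hF hcl ↦ hG ?_).trans ?_
  · exact subdivision_top_isContained_of_le_codegree F hF fun x hx y hy hxy ↦ (hcl hx hy hxy).2
  · rw [lightCount, card_eq_sum_ones, ← sum_add_distrib]
    gcongr with u hu
    have : {v ∈ s | ¬ H.Adj u v} ⊆ {u} ∪ {v ∈ s | G.IsLightPair (t ^ 2 + t) u v} := by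
      intro v hv
      obtain ⟨hv, hn⟩ := mem_filter.1 hv
      by_cases huv : u = v
      · simp [huv]
      · refine mem_union_right _ (mem_filter.2 ⟨hv, huv, ?_, ?_⟩)
        · exact codegree_pos_of_adj (hs u hu) (hs v hv)
        · by_contra h
          exact hn ⟨huv, not_lt.1 h⟩
    exact (card_le_card this).trans (card_union_le _ _)

/-- Double counting of the light pairs in `U` with a common neighbour, summed over the common
neighbour. -/
theorem sq_sum_degree_le (hG : (⊤ : SimpleGraph (Fin t)).subdivision.Free G)
    (U : Finset V) :
    (∑ u ∈ U, G.degree u) ^ 2 ≤ Fintype.card V * t *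
      (∑ u ∈ U, G.degree u + (t ^ 2 + t) * G.lightCount (t ^ 2 + t) U) := by
  have hE : ∑ u ∈ U, G.degree u = ∑ b, #{u ∈ U | G.Adj b u} := by
    simp_rw [← card_neighborFinset_eq_degree, neighborFinset_eq_filter, card_filter]
    rw [sum_comm]
    simp_rw [G.adj_comm]
  have hL : ∑ b, G.lightCount (t ^ 2 + t) {u ∈ U | G.Adj b u} ≤
      (t ^ 2 + t) * G.lightCount (t ^ 2 + t) U := by
    calc ∑ b, G.lightCount (t ^ 2 + t) {u ∈ U | G.Adj b u}
        = ∑ b, ∑ u ∈ U, ∑ v ∈ U,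
            if G.Adj b u ∧ G.Adj b v ∧ G.IsLightPair (t ^ 2 + t) u v then 1 else 0 := by
          simp only [lightCount, card_filter, sum_filter]
          refine sum_congr rfl fun b _ ↦ sum_congr rfl fun u _ ↦ ?_
          by_cases h : G.Adj b u <;> simp [h, ite_and]
      _ = ∑ u ∈ U, ∑ v ∈ U,
            #{b | G.Adj b u ∧ G.Adj b v ∧ G.IsLightPair (t ^ 2 + t) u v} := by
          rw [sum_comm]
          refine sum_congr rfl fun u _ ↦ ?_
          rw [sum_comm]
          simp_rw [card_filter]
      _ ≤ ∑ u ∈ U, ∑ v ∈ U, (t ^ 2 + t) * if G.IsLightPair (t ^ 2 + t) u v then 1 else 0 := by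
          gcongr with u _ v _
          split_ifs with h
          · have : ({b | G.Adj b u ∧ G.Adj b v ∧ G.IsLightPair (t ^ 2 + t) u v} : Finset V) ⊆
                G.neighborFinset u ∩ G.neighborFinset v := by
              intro b hb
              obtain ⟨hu, hv, -⟩ := (mem_filter_univ b).1 hb
              simp [hu.symm, hv.symm]
            rw [mul_one]
            exact (card_le_card this).trans h.2.2.le
          · simp [h]
      _ = _ := by
          simp_rw [lightCount, card_filter, mul_sum]
  calc (∑ u ∈ U, G.degree u) ^ 2 = (∑ b, #{u ∈ U | G.Adj b u}) ^ 2 := by rw [hE]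
    _ ≤ Fintype.card V * ∑ b, #{u ∈ U | G.Adj b u} ^ 2 := sq_sum_le_card_mul_sum_sq
    _ ≤ Fintype.card V * ∑ b, t * (#{u ∈ U | G.Adj b u} +
          G.lightCount (t ^ 2 + t) {u ∈ U | G.Adj b u}) := by
        gcongr with b
        exact sq_card_le_of_common_neighbor hG b _ (by simp)
    _ ≤ _ := by
        rw [← mul_sum, sum_add_distrib, ← hE, mul_assoc]
        gcongr

end Light

/-! ### Greedy selection of branch vertices -/

section Selection

variable {V : Type*} [Fintype V] [DecidableEq V] (G : SimpleGraph V) [DecidableRel G.Adj]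

/-- An independent set `F` of pairwise light vertices, no three of which have a common neighbour,
together with a reservoir `U` of vertices each of which can be added to `F`. -/
structure IsLightSystem (T : ℕ) (F U : Finset V) : Prop where
  isLightPair : ∀ x ∈ F, ∀ y ∈ F, x ≠ y → G.IsLightPair T x y
  not_adj : ∀ x ∈ F, ∀ y ∈ F, ¬ G.Adj x y
  eq_or_eq : ∀ b, ∀ x ∈ F, ∀ y ∈ F, ∀ z ∈ F, x ≠ y → G.Adj b x → G.Adj b y → G.Adj b z →
    z = x ∨ z = y
  isLightPair_of_mem : ∀ v ∈ U, ∀ x ∈ F, G.IsLightPair T x v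
  not_adj_of_mem : ∀ v ∈ U, ∀ x ∈ F, ¬ G.Adj x v
  not_adj_of_adj : ∀ v ∈ U, ∀ b, ∀ x ∈ F, ∀ y ∈ F, x ≠ y → G.Adj b x → G.Adj b y → ¬ G.Adj b v

variable {G}

/-- In a light system each pair of `F` has a common neighbour, and these are distinct because no
three vertices of `F` share one. -/
theorem IsLightSystem.subdivision_top_isContained {t T : ℕ} {F U : Finset V}
    (h : G.IsLightSystem T F U) (hF : #F = t) :
    (⊤ : SimpleGraph (Fin t)).subdivision ⊑ G := by
  let f : Fin t ≃ F := (Fintype.equivFinOfCardEq (by simpa using hF)).symm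
  have hf {i j : Fin t} (hij : i ≠ j) : (f i : V) ≠ f j :=
    fun h ↦ hij (f.injective (Subtype.ext h))
  have key (e : (⊤ : SimpleGraph (Fin t)).edgeSet) :
      ∃ b, ∀ i ∈ (e : Sym2 (Fin t)), G.Adj b (f i) := by
    obtain ⟨e, he⟩ := e
    induction e with | _ i j =>
    obtain ⟨b, hb⟩ := card_pos.1
      (h.isLightPair _ (f i).2 _ (f j).2 (hf (by simpa using he))).2.1
    exact ⟨b, by simpa [G.adj_comm b] using hb⟩
  choose g hg using key
  refine subdivision_isContained_of_injective (fun i ↦ (f i : V)) g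
    (Subtype.val_injective.comp f.injective) ?_ ?_ fun e w hw ↦ (hg e w hw).symm
  · intro e e' hee
    have h1 := hg e
    have h2 := hg e'
    rw [← hee] at h2
    generalize g e = b at h1 h2
    clear hee
    obtain ⟨e, he⟩ := e
    obtain ⟨e', he'⟩ := e'
    induction e with | _ i j =>
    induction e' with | _ k l =>
    have hij : i ≠ j := by simpa using he
    have hkl : k ≠ l := by simpa using he'
    simp only [Sym2.mem_iff, forall_eq_or_imp, forall_eq] at h1 h2
    have h3 {m : Fin t} (hm : G.Adj b (f m)) : m = i ∨ m = j := by
      have := h.eq_or_eq b _ (f i).2 _ (f j).2 _ (f m).2 (hf hij) h1.1 h1.2 hm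
      simpa [← Subtype.ext_iff] using this
    have hk := h3 h2.1
    have hl := h3 h2.2
    rw [Subtype.mk.injEq, Sym2.eq_iff]
    grind
  · intro w e hw
    obtain ⟨e, he⟩ := e
    induction e with | _ i j =>
    have h1 := hg ⟨s(i, j), he⟩ i (by simp)
    rw [← hw] at h1
    exact h.not_adj _ (f w).2 _ (f i).2 h1

/-- Move `u` from the reservoir to `F`. Besides the vertices that do not form a light pair with `u`,
the reservoir loses only the neighbours of `u` and of the few common neighbours of `u` with `F`. -/
theorem IsLightSystem.exists_insert {T D : ℕ} {F U : Finset V} (h : G.IsLightSystem T F U)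
    (hD : ∀ v, G.degree v ≤ D) {u : V} (hu : u ∈ U) :
    ∃ U', G.IsLightSystem T (insert u F) U' ∧
      #{v ∈ U | G.IsLightPair T u v} ≤ #U' + (D + #F * T * D) := by
  -- The discarded vertices: adjacent to `u`, or to a common neighbour of `u` and some `x ∈ F`.
  let X : Finset V := G.neighborFinset u ∪
    F.biUnion fun x ↦ (G.neighborFinset x ∩ G.neighborFinset u).biUnion
      (G.neighborFinset ·)
  have hX {v : V} (hv : v ∉ X) :
      ¬ G.Adj u v ∧ ∀ x ∈ F, ∀ b, G.Adj b x → G.Adj b u → ¬ G.Adj b v := by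
    simp only [X, mem_union, mem_neighborFinset, mem_biUnion, mem_inter, not_or, not_exists,
      not_and] at hv
    exact ⟨hv.1, fun x hx b hbx hbu ↦ hv.2 x hx b ⟨hbx.symm, hbu.symm⟩⟩
  have hne {x : V} (hx : x ∈ F) : u ≠ x := (h.isLightPair_of_mem u hu x hx).1.symm
  refine ⟨{v ∈ U | G.IsLightPair T u v} \ X, ⟨?_, ?_, ?_, ?_, ?_, ?_⟩, ?_⟩
  · simp only [mem_insert]
    rintro x (rfl | hx) y (rfl | hy) hxy
    · exact absurd rfl hxy
    · exact (h.isLightPair_of_mem _ hu y hy).symm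
    · exact h.isLightPair_of_mem _ hu x hx
    · exact h.isLightPair x hx y hy hxy
  · simp only [mem_insert]
    rintro x (rfl | hx) y (rfl | hy)
    · exact G.irrefl
    · exact fun h' ↦ h.not_adj_of_mem _ hu y hy h'.symm
    · exact h.not_adj_of_mem _ hu x hx
    · exact h.not_adj x hx y hy
  · have h1 := h.eq_or_eq
    have h2 := h.not_adj_of_adj u hu
    simp only [mem_insert]
    rintro b x (rfl | hx) y (rfl | hy) z (rfl | hz) hxy hbx hby hbz
    · exact .inl rfl
    · exact absurd rfl hxy
    · exact .inl rfl
    · by_cases hyz : z = y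
      · exact .inr hyz
      · exact absurd hbx (h2 b y hy z hz (Ne.symm hyz) hby hbz)
    · exact .inr rfl
    · by_cases hxz : z = x
      · exact .inl hxz
      · exact absurd hby (h2 b x hx z hz (Ne.symm hxz) hbx hbz)
    · exact absurd hbz (h2 b x hx y hy hxy hbx hby)
    · exact h1 b x hx y hy z hz hxy hbx hby hbz
  · intro v hv
    simp only [mem_sdiff, mem_filter] at hv
    simp only [mem_insert]
    rintro x (rfl | hx)
    · exact hv.1.2
    · exact h.isLightPair_of_mem v hv.1.1 x hx
  · intro v hv
    simp only [mem_sdiff, mem_filter] at hv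
    simp only [mem_insert]
    rintro x (rfl | hx)
    · exact (hX hv.2).1
    · exact h.not_adj_of_mem v hv.1.1 x hx
  · intro v hv
    simp only [mem_sdiff, mem_filter] at hv
    have h2 := (hX hv.2).2
    simp only [mem_insert]
    rintro b x (rfl | hx) y (rfl | hy) hxy hbx hby
    · exact absurd rfl hxy
    · exact h2 y hy b hby hbx
    · exact h2 x hx b hbx hby
    · exact h.not_adj_of_adj v hv.1.1 b x hx y hy hxy hbx hby
  · have hXcard : #X ≤ D + #F * T * D := by
      refine (card_union_le _ _).trans (add_le_add ?_ ?_)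
      · exact (G.card_neighborFinset_eq_degree u).trans_le (hD u)
      · rw [mul_assoc]
        refine card_biUnion_le_card_mul _ _ _ fun x hx ↦ ?_
        refine (card_biUnion_le_card_mul _ _ D fun b _ ↦ ?_).trans
          (Nat.mul_le_mul_right _ (h.isLightPair_of_mem u hu x hx).2.2.le)
        exact (G.card_neighborFinset_eq_degree b).trans_le (hD b)
    have := le_card_sdiff X {v ∈ U | G.IsLightPair T u v}
    lia

/-- In a large set `U` the double count of light pairs provides a vertex with light partners in a
proportion `2 r` of `U`. One factor `r` is left once half of the partners are discarded. -/
theorem exists_mem_mul_le_card_isLightPair {t : ℕ}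
    (hG : (⊤ : SimpleGraph (Fin t)).subdivision.Free G) {n d r : ℝ} (hn : 0 < n) (ht : 0 < t)
    (hV : Fintype.card V ≤ n) (hd : ∀ v, d ≤ G.degree v) (hd0 : 0 ≤ d)
    (hr : 4 * n * t * (t ^ 2 + t) * r ≤ d ^ 2) {U : Finset V} (hU : 2 * n * t ≤ #U * d) :
    ∃ u ∈ U, 2 * r * #U ≤ #{v ∈ U | G.IsLightPair (t ^ 2 + t) u v} := by
  have ht' : (0 : ℝ) < t := by exact_mod_cast ht
  have hU0 : U.Nonempty := by
    rw [nonempty_iff_ne_empty]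
    rintro rfl
    have : 0 < 2 * n * t := by positivity
    simp at hU
    linarith
  have hUpos : (0 : ℝ) < #U := by exact_mod_cast hU0.card_pos
  by_contra! hcon
  set T : ℝ := t ^ 2 + t with hT
  have hT0 : 0 < T := by positivity
  have hL : (G.lightCount (t ^ 2 + t) U : ℝ) < 2 * r * #U ^ 2 := by
    rw [lightCount, Nat.cast_sum]
    refine (sum_lt_sum_of_nonempty hU0 hcon).trans_eq ?_
    rw [sum_const, nsmul_eq_mul]; ring
  have hE : #U * d ≤ ∑ u ∈ U, (G.degree u : ℝ) := by
    rw [← nsmul_eq_mul]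
    exact card_nsmul_le_sum _ _ _ fun v _ ↦ hd v
  have hsq : (∑ u ∈ U, (G.degree u : ℝ)) ^ 2 ≤ n * t *
      (∑ u ∈ U, (G.degree u : ℝ) + T * G.lightCount (t ^ 2 + t) U) := by
    refine le_trans (b := (Fintype.card V * t *
      (∑ u ∈ U, (G.degree u : ℝ) + T * G.lightCount (t ^ 2 + t) U) : ℝ)) ?_ ?_
    · rw [hT]; exact_mod_cast sq_sum_degree_le hG U
    · gcongr
  set E := ∑ u ∈ U, (G.degree u : ℝ)
  -- As `E ≥ 2 n t`, the linear term of the double count is at most half of the left-hand side.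
  have h1 : E ^ 2 ≤ 2 * (n * t * (T * G.lightCount (t ^ 2 + t) U)) := by
    have : 2 * n * t * E ≤ E * E := mul_le_mul_of_nonneg_right (hU.trans hE) (by positivity)
    linarith
  have h2 : (#U * d) ^ 2 ≤ E ^ 2 := by gcongr
  have h3 : n * t * T * (G.lightCount (t ^ 2 + t) U : ℝ) < n * t * T * (2 * r * #U ^ 2) := by
    gcongr
  have h4 : (#U : ℝ) ^ 2 * (4 * n * t * T * r) ≤ #U ^ 2 * d ^ 2 := by gcongr
  linarith

/-- A graph of minimum degree at least `d` and maximum degree at most `D` contains the subdivision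
of `K_t`, if the reservoir shrinks by at most a factor `r` in each of the `t` selections and stays
large enough throughout. -/
theorem subdivision_top_isContained_of_degree {t : ℕ} {n d D r : ℝ} (hn : 0 < n) (ht : 0 < t)
    (hV : Fintype.card V ≤ n) (hd : ∀ v, d ≤ G.degree v) (hd0 : 0 ≤ d)
    (hD : ∀ v, G.degree v ≤ D) (hD0 : 0 ≤ D) (hr0 : 0 ≤ r)
    (hr1 : r ≤ 1) (hr : 4 * n * t * (t ^ 2 + t) * r ≤ d ^ 2)
    (h1 : (1 + t * (t ^ 2 + t)) * D ≤ r ^ t * Fintype.card V)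
    (h2 : 2 * n * t ≤ r ^ t * Fintype.card V * d) :
    (⊤ : SimpleGraph (Fin t)).subdivision ⊑ G := by
  by_contra hG
  have key (k : ℕ) (hk : k ≤ t) : ∃ F U : Finset V, G.IsLightSystem (t ^ 2 + t) F U ∧ #F = k ∧
      r ^ k * Fintype.card V ≤ #U := by
    induction k with
    | zero => exact ⟨∅, univ, ⟨by simp, by simp, by simp, by simp, by simp, by simp⟩, by simp⟩
    | succ k ih =>
      obtain ⟨F, U, h, hF, hU⟩ := ih (by lia)
      have hrU : r ^ t * Fintype.card V ≤ r * #U := by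
        calc r ^ t * Fintype.card V ≤ r ^ (k + 1) * Fintype.card V :=
              mul_le_mul_of_nonneg_right (pow_le_pow_of_le_one hr0 hr1 hk) (by positivity)
          _ = r * (r ^ k * Fintype.card V) := by ring
          _ ≤ r * #U := by gcongr
      have hrU' : r * #U ≤ #U := mul_le_of_le_one_left (by positivity) hr1
      obtain ⟨u, hu, hlight⟩ := exists_mem_mul_le_card_isLightPair hG hn ht hV hd hd0 hr
        (h2.trans (mul_le_mul_of_nonneg_right (hrU.trans hrU') hd0))
      obtain ⟨U', h', hU'⟩ := h.exists_insert (D := ⌊D⌋₊) (fun v ↦ Nat.le_floor (hD v)) hu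
      have huF : u ∉ F := fun hx ↦ (h.isLightPair_of_mem u hu u hx).1 rfl
      refine ⟨_, U', h', by rw [card_insert_of_notMem huF, hF], ?_⟩
      have hU'' : (#{v ∈ U | G.IsLightPair (t ^ 2 + t) u v} : ℝ) ≤
          #U' + (D + k * (t ^ 2 + t) * D) := by
        rw [hF] at hU'
        refine le_trans (b := (#U' + (⌊D⌋₊ + k * (t ^ 2 + t) * ⌊D⌋₊) : ℝ))
          (by exact_mod_cast hU') ?_
        have := Nat.floor_le hD0
        gcongr
      have hkt : (D + k * (t ^ 2 + t) * D : ℝ) ≤ (1 + t * (t ^ 2 + t)) * D := by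
        have : (k : ℝ) ≤ t := by exact_mod_cast (by lia : k ≤ t)
        rw [add_mul, one_mul]
        gcongr
      have h5 : r ^ (k + 1) * Fintype.card V ≤ r * #U := by
        rw [pow_succ', mul_assoc]; gcongr
      linarith
  obtain ⟨F, U, h, hF, -⟩ := key t le_rfl
  exact hG (h.subdivision_top_isContained hF)

end Selection

/-! ### Passing to a subgraph with controlled degrees -/

section Cleaning

variable {V : Type*} [DecidableEq V] (G : SimpleGraph V) [DecidableRel G.Adj]

theorem sum_card_adj_erase {W : Finset V} {v : V} (hv : v ∈ W) :
    ∑ u ∈ W, #{w ∈ W | G.Adj u w} =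
      ∑ u ∈ W.erase v, #{w ∈ W.erase v | G.Adj u w} + 2 * #{w ∈ W | G.Adj v w} := by
  have h (u : V) : #{w ∈ W | G.Adj u w} =
      #{w ∈ W.erase v | G.Adj u w} + if G.Adj u v then 1 else 0 := by
    rw [card_filter, card_filter, ← sum_erase_add _ _ hv]
  rw [← sum_erase_add _ _ hv, sum_congr rfl fun u _ ↦ h u, sum_add_distrib]
  have h2 : ∑ u ∈ W.erase v, (if G.Adj u v then 1 else 0) = #{w ∈ W | G.Adj v w} := by
    rw [card_filter, ← sum_erase_add _ _ hv]
    simp [G.adj_comm v]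
  rw [h2]; ring

/-- A subset `W` of `X` maximizing `2 e(W) - 2 d |W|` spans a graph of minimum degree at least `d`,
since deleting a vertex of smaller degree would increase this quantity. -/
theorem exists_subset_le_card_adj (X : Finset V) (d : ℝ) :
    ∃ W ⊆ X, (∀ v ∈ W, d ≤ #{w ∈ W | G.Adj v w}) ∧
      (∑ u ∈ X, #{w ∈ X | G.Adj u w} : ℕ) - 2 * d * #X ≤
        (∑ u ∈ W, #{w ∈ W | G.Adj u w} : ℕ) - 2 * d * #W := by
  obtain ⟨W, hW, hmax⟩ := exists_max_image X.powerset
    (fun W ↦ ((∑ u ∈ W, #{w ∈ W | G.Adj u w} : ℕ) - 2 * d * #W : ℝ)) ⟨X, mem_powerset_self X⟩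
  rw [mem_powerset] at hW
  refine ⟨W, hW, fun v hv ↦ ?_, hmax X (mem_powerset_self X)⟩
  have h := hmax (W.erase v) (mem_powerset.2 ((erase_subset v W).trans hW))
  rw [G.sum_card_adj_erase hv, ← card_erase_add_one hv] at h
  push_cast at h
  linarith

variable [Fintype V]

/-- Deleting the vertices of a set `S` destroys at most `∑ v ∈ S, deg v` edges. -/
theorem two_mul_card_edgeFinset_le (S : Finset V) :
    2 * #G.edgeFinset ≤ ∑ u ∈ Sᶜ, #{w ∈ Sᶜ | G.Adj u w} + 2 * ∑ v ∈ S, G.degree v := by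
  have hdeg (v : V) : G.degree v = ∑ w, if G.Adj v w then 1 else 0 := by
    rw [← card_neighborFinset_eq_degree, neighborFinset_eq_filter, card_filter]
  have h1 : ∑ v, G.degree v = ∑ v ∈ S, G.degree v + ∑ v ∈ Sᶜ, G.degree v :=
    (sum_add_sum_compl S _).symm
  have h2 : ∑ v ∈ Sᶜ, G.degree v = ∑ v ∈ Sᶜ, (∑ w ∈ S, if G.Adj v w then 1 else 0) +
      ∑ v ∈ Sᶜ, #{w ∈ Sᶜ | G.Adj v w} := by
    rw [← sum_add_distrib]
    refine sum_congr rfl fun v _ ↦ ?_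
    rw [hdeg, card_filter, sum_add_sum_compl]
  have h3 : ∑ v ∈ Sᶜ, (∑ w ∈ S, if G.Adj v w then 1 else 0) ≤ ∑ v ∈ S, G.degree v := by
    rw [sum_comm]
    refine sum_le_sum fun w _ ↦ ?_
    rw [hdeg]
    simp_rw [G.adj_comm w]
    exact sum_le_sum_of_subset (subset_univ _)
  have h4 := sum_degrees_eq_twice_card_edges G
  lia

variable {G}

/-- The vertices of degree larger than a suitable multiple of `√n` carry only linearly many edges:
otherwise the double count of light pairs among them would exceed the number of all pairs. -/
theorem sum_degree_le_of_lt_degree {t : ℕ}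
    (hG : (⊤ : SimpleGraph (Fin t)).subdivision.Free G) {n D : ℝ} (hD0 : 0 ≤ D)
    (hV : Fintype.card V ≤ n) (hD : 2 * n * t * (t ^ 2 + t) ≤ D ^ 2) (S : Finset V)
    (hS : ∀ v ∈ S, D < G.degree v) :
    ∑ v ∈ S, (G.degree v : ℝ) ≤ 2 * n * t := by
  by_contra! hcon
  have hn : 0 ≤ n := (Nat.cast_nonneg _).trans hV
  have hS0 : S.Nonempty := by
    rw [nonempty_iff_ne_empty]
    rintro rfl
    rw [sum_empty] at hcon
    exact hcon.not_ge (by positivity)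
  have hE : #S * D < ∑ u ∈ S, (G.degree u : ℝ) := by
    rw [← nsmul_eq_mul, ← sum_const]
    exact sum_lt_sum_of_nonempty hS0 hS
  have hL : (G.lightCount (t ^ 2 + t) S : ℝ) ≤ #S ^ 2 := by
    have : G.lightCount (t ^ 2 + t) S ≤ #S ^ 2 := by
      rw [lightCount]
      exact (sum_le_sum (g := fun _ ↦ #S) fun u _ ↦ card_filter_le _ _).trans_eq (by simp [sq])
    exact_mod_cast this
  have hsq : (∑ u ∈ S, (G.degree u : ℝ)) ^ 2 ≤ n * t *
      (∑ u ∈ S, (G.degree u : ℝ) + (t ^ 2 + t) * #S ^ 2) := by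
    refine le_trans (b := (Fintype.card V * t *
      (∑ u ∈ S, (G.degree u : ℝ) + (t ^ 2 + t) * G.lightCount (t ^ 2 + t) S) : ℝ)) ?_ ?_
    · exact_mod_cast sq_sum_degree_le hG S
    · gcongr
  set E := ∑ u ∈ S, (G.degree u : ℝ)
  have h0 : 0 ≤ #S * D := by positivity
  have h1 : 2 * n * t * E ≤ E * E := mul_le_mul_of_nonneg_right hcon.le (h0.trans hE.le)
  have h2 : (#S * D) ^ 2 < E ^ 2 := by gcongr
  have h3 : (#S : ℝ) ^ 2 * (2 * n * t * (t ^ 2 + t)) ≤ #S ^ 2 * D ^ 2 := by gcongr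
  linarith

end Cleaning

/-! ### The extremal number -/

/-- The parameter `y` stands for `n ^ (1 / (4 t + 4))`, so that all quantities of the argument are
integral powers of `y`. -/
theorem card_edgeFinset_le_of_free {V : Type*} [Fintype V] {G : SimpleGraph V} [DecidableRel G.Adj]
    {t : ℕ} (ht : 0 < t) (hG : (⊤ : SimpleGraph (Fin t)).subdivision.Free G) {a y : ℝ}
    (ha : a = t * (t ^ 2 + t)) (hy : 1 ≤ y) (hV : Fintype.card V ≤ y ^ (4 * t + 4)) :
    (#G.edgeFinset : ℝ) ≤ 32 * a ^ 2 * (1 + a) * y ^ (6 * t + 5) := by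
  classical
  by_contra! hcon
  have ht1 : (1 : ℝ) ≤ t := by exact_mod_cast ht
  have hta : (t : ℝ) ≤ a := by rw [ha]; nlinarith [sq_nonneg (t : ℝ)]
  have ha1 : 1 ≤ a := ht1.trans hta
  have hy0 : 0 < y := by linarith
  set C := 32 * a ^ 2 * (1 + a) with hC
  have hCa : 32 * a ≤ C := by
    have : 1 ≤ a * (1 + a) := by nlinarith
    calc 32 * a = 32 * a * 1 := by ring
      _ ≤ 32 * a * (a * (1 + a)) := by gcongr
      _ = C := by ring
  have hC2 : 32 * a * (32 * a) ≤ C * C := by gcongr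
  -- The threshold for large degrees and the minimum degree of the subgraph that is kept.
  set D := 2 * a * y ^ (2 * t + 2) with hD
  set d := C / 4 * y ^ (2 * t + 1) with hd
  set S : Finset V := {v | D < G.degree v} with hSdef
  have hS : ∑ v ∈ S, (G.degree v : ℝ) ≤ 2 * y ^ (4 * t + 4) * t := by
    refine sum_degree_le_of_lt_degree (D := D) hG (by positivity) hV ?_ S (by simp [hSdef])
    rw [mul_assoc, ← ha, hD]
    have : y ^ (4 * t + 4) * (2 * a) ≤ y ^ (4 * t + 4) * (4 * a ^ 2) := by
      gcongr
      · norm_num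
      · nlinarith
    calc 2 * y ^ (4 * t + 4) * a = y ^ (4 * t + 4) * (2 * a) := by ring
      _ ≤ _ := this
      _ = _ := by ring
  obtain ⟨W, hWS, hdeg, hW⟩ := G.exists_subset_le_card_adj Sᶜ d
  have hedge : (2 * #G.edgeFinset : ℝ) ≤ (∑ u ∈ Sᶜ, #{w ∈ Sᶜ | G.Adj u w} : ℕ) +
      2 * ∑ v ∈ S, (G.degree v : ℝ) := by
    exact_mod_cast G.two_mul_card_edgeFinset_le S
  have hmaxdeg (v : V) (hv : v ∈ W) : (#{w ∈ W | G.Adj v w} : ℝ) ≤ D := by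
    have h1 : #{w ∈ W | G.Adj v w} ≤ G.degree v := by
      rw [← card_neighborFinset_eq_degree, neighborFinset_eq_filter]
      exact card_le_card (filter_subset_filter _ (subset_univ _))
    have h2 : (G.degree v : ℝ) ≤ D := by simpa [hSdef] using hWS hv
    exact le_trans (by exact_mod_cast h1) h2
  have hWD : ((∑ u ∈ W, #{w ∈ W | G.Adj u w} : ℕ) : ℝ) ≤ #W * D := by
    rw [Nat.cast_sum, ← nsmul_eq_mul]
    exact sum_le_card_nsmul _ _ _ hmaxdeg
  have hX : (#Sᶜ : ℝ) ≤ y ^ (4 * t + 4) := le_trans (by exact_mod_cast card_le_univ _) hV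
  have hdX : 2 * d * #Sᶜ ≤ C / 2 * y ^ (6 * t + 5) := by
    calc 2 * d * #Sᶜ ≤ 2 * d * y ^ (4 * t + 4) := by gcongr
      _ = C / 2 * y ^ (6 * t + 5) := by rw [hd]; ring
  have hlin : 4 * y ^ (4 * t + 4) * t ≤ C / 2 * y ^ (6 * t + 5) := by
    calc 4 * y ^ (4 * t + 4) * t = 4 * t * y ^ (4 * t + 4) := by ring
      _ ≤ C / 2 * y ^ (6 * t + 5) := by
        gcongr
        · linarith
        · lia
        · lia
  have hdW : 0 ≤ 2 * d * #W := by positivity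
  have hWcard : C * y ^ (6 * t + 5) ≤ #W * D := by linarith
  have hWcard' : C / (2 * a) * y ^ (2 * t + 3) ≤ (y ^ 2)⁻¹ ^ t * #W := by
    rw [← mul_le_mul_iff_of_pos_left (show 0 < 2 * a * y ^ (4 * t + 2) by positivity)]
    calc 2 * a * y ^ (4 * t + 2) * (C / (2 * a) * y ^ (2 * t + 3))
        = C * y ^ (6 * t + 5) := by field_simp; ring
      _ ≤ #W * D := hWcard
      _ = _ := by
        rw [hD, inv_pow]; field_simp; ring
  have hcardW : Fintype.card (W : Set V) = #W := by simp
  have hdegW (v : (W : Set V)) : (G.induce (W : Set V)).degree v = #{w ∈ W | G.Adj v w} := by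
    rw [← card_neighborFinset_eq_degree, neighborFinset_eq_filter, ← card_map (.subtype _)]
    congr 1
    ext x
    simp [and_comm]
  refine hG (IsContained.trans ?_ (Copy.induce G (W : Set V)).isContained)
  refine subdivision_top_isContained_of_degree (n := y ^ (4 * t + 4)) (d := d) (D := D)
    (r := (y ^ 2)⁻¹) (by positivity) ht ?_ ?_ (by positivity) ?_ (by positivity) (by positivity)
    (inv_le_one_of_one_le₀ (one_le_pow₀ hy)) ?_ ?_ ?_
  · exact le_trans (by exact_mod_cast Fintype.card_subtype_le _) hV
  · intro v
    rw [hdegW]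
    exact hdeg v v.2
  · intro v
    rw [hdegW]
    exact hmaxdeg v v.2
  · rw [mul_assoc (4 * _), ← ha]
    calc 4 * y ^ (4 * t + 4) * a * (y ^ 2)⁻¹ = 4 * a * y ^ (4 * t + 2) := by field_simp; ring
      _ ≤ C * C / 16 * y ^ (4 * t + 2) := by gcongr; nlinarith
      _ = d ^ 2 := by rw [hd]; ring
  · rw [hcardW, ← ha]
    refine le_trans ?_ hWcard'
    calc (1 + a) * D = 2 * a * (1 + a) * y ^ (2 * t + 2) := by rw [hD]; ring
      _ ≤ C / (2 * a) * y ^ (2 * t + 3) := by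
        gcongr
        · rw [le_div_iff₀ (by positivity)]
          nlinarith [show 0 ≤ a ^ 2 * (1 + a) by positivity]
        · lia
  · rw [hcardW]
    refine le_trans ?_ (mul_le_mul_of_nonneg_right hWcard' (by positivity))
    calc 2 * y ^ (4 * t + 4) * t = 2 * t * y ^ (4 * t + 4) := by ring
      _ ≤ C * C / (8 * a) * y ^ (4 * t + 4) := by
        gcongr
        rw [le_div_iff₀ (by positivity)]
        nlinarith
      _ = C / (2 * a) * y ^ (2 * t + 3) * d := by rw [hd]; field_simp; ring

theorem exists_extremalNumber_subdivision_top_le {t : ℕ} (ht : 0 < t) :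
    ∃ C δ : ℝ, 0 < C ∧ 0 < δ ∧ ∀ n : ℕ,
      (extremalNumber n (⊤ : SimpleGraph (Fin t)).subdivision : ℝ) ≤
        C * (n : ℝ) ^ ((3 / 2 : ℝ) - δ) := by
  have ht0 : (0 : ℝ) < t := by exact_mod_cast ht
  set a : ℝ := t * (t ^ 2 + t) with ha
  refine ⟨32 * a ^ 2 * (1 + a), 1 / (4 * t + 4), by positivity, by positivity, fun n ↦ ?_⟩
  rw [← Fintype.card_fin n, extremalNumber_le_iff_of_nonneg _ (by positivity)]
  intro G _ hG
  rw [Fintype.card_fin]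
  obtain rfl | hn := n.eq_zero_or_pos
  · have : #G.edgeFinset = 0 := by simp [Subsingleton.elim G ⊥]
    rw [this, Nat.cast_zero]
    positivity
  have hn1 : (1 : ℝ) ≤ n := by exact_mod_cast hn
  have h := card_edgeFinset_le_of_free ht hG ha (y := (n : ℝ) ^ (1 / (4 * t + 4) : ℝ))
    (Real.one_le_rpow hn1 (by positivity)) ?_
  · refine h.trans_eq ?_
    congr 1
    rw [← Real.rpow_natCast, ← Real.rpow_mul (by positivity)]
    congr 1
    push_cast
    field_simp
    ring
  · rw [← Real.rpow_natCast, ← Real.rpow_mul (by positivity), Fintype.card_fin]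
    apply le_of_eq
    push_cast
    rw [one_div_mul_cancel (by positivity), Real.rpow_one]

theorem exists_extremalNumber_subdivision_le {W : Type*} [Finite W] (G : SimpleGraph W) :
    ∃ C δ : ℝ, 0 < C ∧ 0 < δ ∧ ∀ n : ℕ,
      (extremalNumber n G.subdivision : ℝ) ≤ C * (n : ℝ) ^ ((3 / 2 : ℝ) - δ) := by
  have := Fintype.ofFinite W
  obtain ⟨C, δ, hC, hδ, h⟩ :=
    exists_extremalNumber_subdivision_top_le (t := Fintype.card W + 1) (Nat.succ_pos _)
  refine ⟨C, δ, hC, hδ, fun n ↦ le_trans ?_ (h n)⟩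
  exact_mod_cast (subdivision_isContained_subdivision_top G
    ((Fintype.equivFin W).toEmbedding.trans Fin.castSuccEmb)).extremalNumber_le

end SimpleGraph

/-- The first part is the bound for bipartite `H` without a four-cycle and with all degrees at most
two on one side `B` of a bipartition; the second part is the formulation for the subdivision of an
arbitrary finite graph; the third part is the answer to the question of Erdős on cliques. -/
theorem theorem1p2 :
    (∀ (V : Type*) [Fintype V] (H : SimpleGraph V) [DecidableRel H.Adj] (A B : Set V),
      H.IsBipartiteWith A B → (∀ v ∈ B, H.degree v ≤ 2) → (SimpleGraph.cycleGraph 4).Free H →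
        ∃ C δ : ℝ, 0 < C ∧ 0 < δ ∧ ∀ n : ℕ,
          (SimpleGraph.extremalNumber n H : ℝ) ≤ C * (n : ℝ) ^ ((3 / 2 : ℝ) - δ)) ∧
    (∀ (W : Type*) [Finite W] (G : SimpleGraph W),
      ∃ C δ : ℝ, 0 < C ∧ 0 < δ ∧ ∀ n : ℕ,
        (SimpleGraph.extremalNumber n G.subdivision : ℝ) ≤ C * (n : ℝ) ^ ((3 / 2 : ℝ) - δ)) ∧
    (∀ t : ℕ, 3 ≤ t →
      ∃ C α : ℝ, 0 < C ∧ α < 3 / 2 ∧ ∀ n : ℕ,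
        (SimpleGraph.extremalNumber n (SimpleGraph.completeGraph (Fin t)).subdivision : ℝ) ≤
          C * (n : ℝ) ^ α) := by

  refine ⟨fun V _ H _ A B hAB hB hH ↦ ?_, fun W _ G ↦ ?_, fun t ht ↦ ?_⟩
  · obtain ⟨C, δ, hC, hδ, h⟩ := SimpleGraph.exists_extremalNumber_subdivision_le
      (⊤ : SimpleGraph (V × Bool))
    refine ⟨C, δ, hC, hδ, fun n ↦ le_trans ?_ (h n)⟩
    exact_mod_cast (hAB.isContained_subdivision_top hB hH).extremalNumber_le
  · exact SimpleGraph.exists_extremalNumber_subdivision_le G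
  · obtain ⟨C, δ, hC, hδ, h⟩ := SimpleGraph.exists_extremalNumber_subdivision_top_le
      (t := t) (by lia)
    exact ⟨C, 3 / 2 - δ, hC, by linarith, h⟩
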